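/- Let $\lambda,\mu,\beta,\alpha_0>0$ satisfy the stability condition $\lambda<\frac{\beta}{\alpha_0+\beta}\,\mu$, and assume $\mu<\lambda+\beta$. For $0<\alpha\le\alpha_0$ consider Model 1, the unreliable $M/M/1$ queue: the continuous-time Markov chain $(X,\sigma)$ on $\mathbb{N}\times\{Up,Down\}$ ($\mathbb N\ni 0$) with intensities $(x,\sigma)\to(x+1,\sigma)$ at rate $\lambda$, $(x,Up)\to(x-1,Up)$ at rate $\mu$ (for $x\ge1$), $(x,Up)\to(x,Down)$ at rate $\alpha$, $(x,Down)\to(x,Up)$ at rate $\beta$. Fix $C\ge\lambda+\mu+\alpha_0+\beta$ and put $$s_1=(\mu-\lambda-\beta-\alpha)^2+4\alpha\mu,\qquad \gamma_1=\frac{2\lambda}{\lambda+\beta+\mu+\alpha-\sqrt{s_1}},\qquad \omega=\lambda+\beta-\mu-\alpha+\sqrt{s_1},$$ $$G=\frac{\omega}{2}+\frac{2\alpha\beta}{\omega},\qquad \tilde d^{(1)}=\frac1C\left(\frac{\lambda+\beta+\mu+\alpha-\sqrt{s_1}}{2}-\frac{\lambda\mu}{G}\cdot\frac{\omega}{\lambda+\beta+\mu+\alpha-\sqrt{s_1}}\right),$$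 $$h(x,Up)=\gamma_1^{-x},\qquad h(x,Down)=\gamma_1^{-x}\,\frac{2\beta}{\omega}.$$ Let $\mathbf K^\infty$ be the transition kernel on $\mathbb{Z}\times\{Up,Down\}$ of the chain uniformized with the constant $C$ and with the boundary removed: $(x,\sigma)\to(x+1,\sigma)$ with probability $\lambda/C$, $(x,Up)\to(x-1,Up)$ with probability $\mu/C$ (for all $x\in\mathbb Z$), $(x,Up)\to(x,Down)$ with probability $\alpha/C$, $(x,Down)\to(x,Up)$ with probability $\beta/C$, and no move with the remaining probability. Let $\mathcal K(z,w)=\mathbf K^\infty(z,w)h(w)/h(z)$ be its $h$-transform (the twisted free process), and let $\mathcal H(z)$ be the probability that the discrete-time Markov chain with kernel $\mathcal K$ started at $z$ satisfies $x\ge1$ at all times $n\ge1$. Then for every $0<\alpha\le\alpha_0$ Model 1 has a unique stationary distribution $\pi=\pi_\alpha$. Put $$\eta^{(1)}=\sum_{\sigma\in\{Up,Down\}}\pi(0,\sigma)\,h(0,\sigma)\,\mathcal H(0,\sigma),\qquad C^{(1)}(Up)=\frac{\eta^{(1)}}{\tilde d^{(1)}}\cdot\frac1G\cdot\frac{\omega}{2}.$$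 Then, with $\lambda,\mu,\beta,C$ fixed and $\alpha\to0$ meaning $\alpha\downarrow0$, for every $k$ the inner limit below exists, and $$\lim_{k\to\infty}\ \lim_{\alpha\to0}\ \frac{\pi(k,Up)}{C^{(1)}(Up)\,\gamma_1^k}=1.$$ Moreover $\lim_{\alpha\to0}\gamma_1=\lambda/\mu$, the limit $\eta_0=\lim_{\alpha\to0}\eta^{(1)}$ exists, and $\lim_{\alpha\to0}C^{(1)}(Up)=\dfrac{\eta_0\,C}{\mu-\lambda}>0$. -/

import Mathlib

open Filter Topology MeasureTheory ProbabilityTheory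

noncomputable section

namespace UnreliableQueue

/-- Status of the server. -/
inductive Status
  | up
  | down
  deriving DecidableEq

instance : Finite Status :=
  Finite.of_injective (fun x : Status => decide (x = .up)) fun x y => by
    cases x <;> cases y <;> simp

instance : MeasurableSpace Status := ⊤

instance : DiscreteMeasurableSpace Status := ⟨fun _ => trivial⟩

/-- The four intensities of the unreliable `M/M/1` system: arrivals (`lam`), service (`mu`),
breakdown `Up → Down` (`alpha`) and repair `Down → Up` (`beta`). -/
structure Rates where
  lam : ℝ
  mu : ℝ
  alpha : ℝ
  beta : ℝ

/-! ### The queue and its stationary distribution -/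

/-- Transition intensities of the continuous-time Markov chain `(X(t), σ(t))` on
`ℕ × {Up, Down}`: customers arrive in both statuses, service takes place only in status `Up`
and only when there is a customer, and the status changes independently of the queue. -/
def intensity (r : Rates) (z w : ℕ × Status) : ℝ :=
  if w.1 = z.1 + 1 ∧ w.2 = z.2 then r.lam
  else if z.1 = w.1 + 1 ∧ z.2 = .up ∧ w.2 = .up then r.mu
  else if w.1 = z.1 ∧ z.2 = .up ∧ w.2 = .down then r.alpha
  else if w.1 = z.1 ∧ z.2 = .down ∧ w.2 = .up then r.beta
  else 0

/-- `p` is a stationary distribution of the chain: a probability vector that satisfies the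
global balance equations (`p Q = 0` for the generator `Q` of the chain). -/
def IsStationary (r : Rates) (p : ℕ × Status → ℝ) : Prop :=
  (∀ z, 0 ≤ p z) ∧ HasSum p 1 ∧
    ∀ z, ∑' w, p w * intensity r w z = p z * ∑' w, intensity r z w

open Classical in
/-- The stationary distribution `π` (with the value `0` if there is none). -/
def stationaryDist (r : Rates) : ℕ × Status → ℝ :=
  if h : ∃ p, IsStationary r p then h.choose else 0

/-! ### Discrete-time Markov chains given by a transition matrix -/

open Classical in
/-- The distribution given by the row `z` of a transition matrix `K` (a point mass at `z` if that
row is not a probability vector). -/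
def rowPMF {S : Type} (K : S → S → ℝ) (z : S) : PMF S :=
  if h : (∀ w, 0 ≤ K z w) ∧ HasSum (K z) 1 then
    ⟨fun w => ENNReal.ofReal (K z w), by
      have := ENNReal.ofReal_tsum_of_nonneg h.1 h.2.summable
      rw [h.2.tsum_eq, ENNReal.ofReal_one] at this
      rw [this]
      exact ENNReal.summable.hasSum⟩
  else PMF.pure z

/-- The transition kernel given by a transition matrix. -/
def chainKernel {S : Type} [MeasurableSpace S] [Countable S] [MeasurableSingletonClass S]
    (K : S → S → ℝ) : Kernel S S :=
  Kernel.ofFunOfCountable fun z => (rowPMF K z).toMeasure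

instance {S : Type} [MeasurableSpace S] [Countable S] [MeasurableSingletonClass S]
    (K : S → S → ℝ) : IsMarkovKernel (chainKernel K) :=
  ⟨fun z => PMF.toMeasure.isProbabilityMeasure (rowPMF K z)⟩

/-- The law on `ℕ → S` of the Markov chain with transition matrix `K` started at `z`. -/
def chainLaw {S : Type} [MeasurableSpace S] [Countable S] [MeasurableSingletonClass S]
    (K : S → S → ℝ) (z : S) : Measure (ℕ → S) :=
  Kernel.traj (X := fun _ => S)
    (fun n => (chainKernel K).comap (fun x => x ⟨n, Finset.mem_Iic.2 le_rfl⟩)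
      (measurable_pi_apply _)) 0 (fun _ => z)

/-! ### The constants of the asymptotics -/

/-- The discriminant `s₁`. -/
def s (r : Rates) : ℝ := (r.mu - r.lam - r.beta - r.alpha) ^ 2 + 4 * r.alpha * r.mu

/-- The decay rate `γ₁`. -/
def gamma (r : Rates) : ℝ :=
  2 * r.lam / (r.lam + r.beta + r.mu + r.alpha - √(s r))

/-- The normalizing constant `G`. -/
def G (r : Rates) : ℝ :=
  (r.lam + r.beta - r.mu - r.alpha + √(s r)) / 2 +
    2 * r.alpha * r.beta / (r.lam + r.beta - r.mu - r.alpha + √(s r))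

/-- The stationary horizontal drift `d̃` of the twisted free process. -/
def drift (r : Rates) (C : ℝ) : ℝ :=
  1 / C * ((r.lam + r.beta + r.mu + r.alpha - √(s r)) / 2 -
    1 / G r * (r.lam * r.mu) * ((r.lam + r.beta - r.mu - r.alpha + √(s r)) /
      (r.lam + r.beta + r.mu + r.alpha - √(s r))))

/-- The kernel of the free process on `ℤ × {Up, Down}`: the chain uniformized with the
constant `C`, with the boundary removed. -/
def freeKernel (r : Rates) (C : ℝ) (z w : ℤ × Status) : ℝ :=
  if w.1 = z.1 + 1 ∧ w.2 = z.2 then r.lam / C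
  else if w.1 = z.1 - 1 ∧ z.2 = .up ∧ w.2 = .up then r.mu / C
  else if w.1 = z.1 ∧ z.2 = .up ∧ w.2 = .down then r.alpha / C
  else if w.1 = z.1 ∧ z.2 = .down ∧ w.2 = .up then r.beta / C
  else if w.1 = z.1 ∧ z.2 = .down ∧ w.2 = .down then 1 - (r.lam + r.beta) / C
  else if w.1 = z.1 ∧ z.2 = .up ∧ w.2 = .up then 1 - (r.alpha + r.mu + r.lam) / C
  else 0

/-- The harmonic function `h` of the free process. -/
def harmonic (r : Rates) : ℤ × Status → ℝ
  | (x, .up) => (1 / gamma r) ^ x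
  | (x, .down) =>
      (1 / gamma r) ^ x * (2 * r.beta / (r.lam + r.beta - r.mu - r.alpha + √(s r)))

/-- The kernel of the twisted free process (the `h`-transform of the free process). -/
def twistedKernel (r : Rates) (C : ℝ) (z w : ℤ × Status) : ℝ :=
  freeKernel r C z w * harmonic r w / harmonic r z

/-- The rows of the twisted kernel are probability vectors, because `h` is positive and harmonic
for the free process. -/
theorem twistedKernel_stochastic (r : Rates) (C : ℝ) (hl : 0 < r.lam) (hm : 0 < r.mu)
    (ha : 0 < r.alpha) (hb : 0 < r.beta) (hC : r.lam + r.mu + r.alpha + r.beta ≤ C)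
    (z : ℤ × Status) :
    (∀ w, 0 ≤ twistedKernel r C z w) ∧ HasSum (twistedKernel r C z) 1 := by
  have hC0 : 0 < C := by linarith
  obtain ⟨q, hq0, hq⟩ : ∃ q : ℝ, 0 ≤ q ∧ q ^ 2 = s r := by
    refine ⟨√(s r), Real.sqrt_nonneg _, Real.sq_sqrt ?_⟩
    unfold s; positivity
  have hsq : √(s r) = q := by rw [← hq, Real.sqrt_sq hq0]
  unfold s at hq
  have hden : 0 < r.lam + r.beta + r.mu + r.alpha - q := by
    have : q < r.lam + r.beta + r.mu + r.alpha := by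
      apply lt_of_pow_lt_pow_left₀ 2 (by positivity)
      nlinarith [mul_pos hm hl, mul_pos hm hb]
    linarith
  have hom : 0 < r.lam + r.beta - r.mu - r.alpha + q := by
    have : -(r.lam + r.beta - r.mu - r.alpha) < q := by
      apply lt_of_pow_lt_pow_left₀ 2 hq0
      nlinarith [mul_pos ha hl, mul_pos ha hb]
    linarith
  have hg : 0 < gamma r := by unfold gamma; rw [hsq]; positivity
  have hh : ∀ w, 0 < harmonic r w := by
    rintro ⟨x, _ | _⟩ <;> simp only [harmonic, hsq] <;> positivity
  have hfree : ∀ w, 0 ≤ freeKernel r C z w := by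
    intro w
    have h1 : (r.lam + r.beta) / C ≤ 1 := by rw [div_le_one hC0]; linarith
    have h2 : (r.alpha + r.mu + r.lam) / C ≤ 1 := by rw [div_le_one hC0]; linarith
    unfold freeKernel
    split_ifs <;> positivity
  refine ⟨fun w => div_nonneg (mul_nonneg (hfree w) (hh w).le) (hh z).le, ?_⟩
  obtain ⟨x, σ⟩ := z
  have key : HasSum (twistedKernel r C (x, σ))
      (∑ w ∈ ({x + 1, x, x - 1} : Finset ℤ) ×ˢ ({.up, .down} : Finset Status),
        twistedKernel r C (x, σ) w) := by
    apply hasSum_sum_of_ne_finset_zero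
    rintro ⟨y, τ⟩ hw
    have h1 : y ≠ x + 1 ∧ y ≠ x ∧ y ≠ x - 1 := by
      refine ⟨?_, ?_, ?_⟩ <;> rintro rfl <;> apply hw <;> cases τ <;> simp
    simp [twistedKernel, freeKernel, h1.1, h1.2.1, h1.2.2]
  convert key using 1
  have hginv : 1 / gamma r = (r.lam + r.beta + r.mu + r.alpha - q) / (2 * r.lam) := by
    unfold gamma; rw [hsq, one_div_div]
  obtain ⟨t, htdef⟩ : ∃ t, t = 1 / gamma r := ⟨_, rfl⟩
  have ht : 0 < t := by rw [htdef]; positivity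
  have hz : 0 < t ^ x := zpow_pos ht x
  have e1 : q = r.lam + r.beta + r.mu + r.alpha - 2 * r.lam * t := by
    rw [htdef, hginv]; field_simp; ring
  have e2 : r.lam + r.beta - r.mu - r.alpha + q = 2 * (r.lam + r.beta - r.lam * t) := by
    rw [e1]; ring
  have e3 : 0 < r.lam + r.beta - r.lam * t := by linarith
  have e4 : r.lam * t ^ 2 * r.lam + r.mu * (r.lam + r.beta) =
      r.lam * (r.beta + r.alpha + r.lam + r.mu) * t := by
    rw [e1] at hq; linarith
  have zp : t ^ (x + 1) = t ^ x * t := zpow_add_one₀ ht.ne' x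
  have zm : t ^ (x - 1) = t ^ x * t⁻¹ := zpow_sub_one₀ ht.ne' x
  have n1 : x + 1 ≠ x - 1 := by omega
  have n2 : x - 1 ≠ x + 1 := by omega
  have n3 : x ≠ x - 1 := by omega
  rw [Finset.sum_product, Finset.sum_insert (by simp [n1])]
  simp only [Finset.sum_pair (show Status.up ≠ Status.down by simp),
    Finset.sum_pair (show x ≠ x - 1 by omega)]
  cases σ <;> simp only [twistedKernel, freeKernel, harmonic, hsq, ← htdef, e2, zp, zm] <;>
    simp [n2, n3]
  · field_simp
    linear_combination (t - 1) * e4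
  · field_simp
    ring

/-- `H(z)`: the probability that the twisted free process started at `z` stays, at all times
`n ≥ 1`, in the interior `{(x, σ) : x ≥ 1}`, that is, never returns to the boundary. -/
def noReturnProb (r : Rates) (C : ℝ) (z : ℤ × Status) : ℝ :=
  (chainLaw (twistedKernel r C) z).real {ω | ∀ n, 1 ≤ n → 1 ≤ (ω n).1}

/-- `η`: the sum of `π h H` over the boundary `{(0, Up), (0, Down)}`. -/
def eta (r : Rates) (C : ℝ) : ℝ :=
  stationaryDist r (0, .up) * harmonic r (0, .up) * noReturnProb r C (0, .up) +
    stationaryDist r (0, .down) * harmonic r (0, .down) * noReturnProb r C (0, .down)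

/-- The constant `C⁽¹⁾(Up)`. -/
def constUp (r : Rates) (C : ℝ) : ℝ :=
  eta r C / drift r C * (1 / G r) * ((r.lam + r.beta - r.mu - r.alpha + √(s r)) / 2)

end UnreliableQueue

end

noncomputable section

namespace UnreliableQueue

/-! Both sides of the ratio can be computed well enough to pass to the limit for each fixed `k`. On
the queue side, equating the flow across the cut between levels `k` and `k + 1` turns the balance
equations into a first-order recursion. Hence the stationary distribution exists, is unique and is
explicit (`isStationary_balanceDist`, `IsStationary.eq_balanceDist`), and as `α ↓ 0` its `Up` part
tends to the M/M/1 law `(1 - ρ) ρ ^ k` with `ρ = lam / mu` (`tendsto_emptyProb`,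
`tendsto_balanceSol`).

On the side of the constant, only the escape probability in `eta` is not a closed formula. In the
interior it equals `1 - 1 / h` (`noReturnProb_eq_escapeProb`): this function is harmonic for the
killed twisted process, and a maximum principle excludes any other candidate. One step from `(0,
Up)` then gives the value needed there. At `(0, Down)` no value is needed, since the stationary mass
of that state tends to zero and a probability is at most one.

The algebraic constants have limits because `mu < lam + beta` fixes the sign of the square root at
`α = 0`. Altogether `eta` tends to `(1 - ρ) (mu - lam) / C` and `constUp` to `1 - ρ`, so the inner
limit is already `1` for each `k`. -/

theorem abs_indicator_le {S : Type} {B : Set S} {f : S → ℝ} {c : ℝ} (hf : ∀ w, |f w| ≤ c) (w : S) :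
    |B.indicator f w| ≤ c :=
  (norm_indicator_le_norm_self f w).trans (hf w)

/-! ### Killed Markov chains: path probabilities as iterates of an operator. -/

section Chain

variable {S : Type} [MeasurableSpace S] [Countable S] [MeasurableSingletonClass S]

instance (K : S → S → ℝ) (z : S) : IsProbabilityMeasure (chainLaw K z) := by
  unfold chainLaw; infer_instance

/-- The transition operator of the chain killed outside of `B`. -/
def killedOp (K : S → S → ℝ) (B : Set S) (f : S → ℝ) (z : S) : ℝ :=
  ∫ y, B.indicator f y ∂chainKernel K z

theorem integral_chainKernel {K : S → S → ℝ} {z : S} (h0 : ∀ w, 0 ≤ K z w)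
    (h1 : HasSum (K z) 1) {f : S → ℝ} {c : ℝ} (hf : ∀ w, |f w| ≤ c) :
    ∫ y, f y ∂chainKernel K z = ∑' w, K z w * f w := by
  have hint : Integrable f (rowPMF K z).toMeasure :=
    Integrable.of_bound (measurable_of_countable f).aestronglyMeasurable c (.of_forall hf)
  change ∫ y, f y ∂(rowPMF K z).toMeasure = _
  rw [PMF.integral_eq_tsum _ _ hint]
  congr 1 with w
  have hrow : rowPMF K z = _ := dif_pos ⟨h0, h1⟩
  have : rowPMF K z w = ENNReal.ofReal (K z w) := by rw [hrow]; rfl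
  rw [this, ENNReal.toReal_ofReal (h0 w), smul_eq_mul]

theorem killedOp_mono {K : S → S → ℝ} {B : Set S} {f g : S → ℝ} {c : ℝ} (hf : ∀ w, |B.indicator f w| ≤ c)
    (hg : ∀ w, |B.indicator g w| ≤ c) (h : ∀ w ∈ B, f w ≤ g w) (z : S) :
    killedOp K B f z ≤ killedOp K B g z := by
  refine integral_mono
    (Integrable.of_bound (measurable_of_countable _).aestronglyMeasurable c (.of_forall hf))
    (Integrable.of_bound (measurable_of_countable _).aestronglyMeasurable c (.of_forall hg))
    fun w => ?_
  exact Set.indicator_le_indicator' (h w)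

theorem abs_killedOp_le (K : S → S → ℝ) (B : Set S) {f : S → ℝ} {c : ℝ} (hf : ∀ w, |f w| ≤ c)
    (z : S) : |killedOp K B f z| ≤ c := by
  have hb : ∀ w, ‖B.indicator f w‖ ≤ c := fun w =>
    (norm_indicator_le_norm_self f w).trans (hf w)
  simpa [killedOp] using norm_integral_le_of_norm_le_const (μ := chainKernel K z) (.of_forall hb)

theorem integral_chainLaw_zero (K : S → S → ℝ) (f : S → ℝ) (z : S) :
    ∫ ω, f (ω 0) ∂chainLaw K z = f z := by
  have hm : Measurable (fun ω : (i : Finset.Iic 0) → S => f (ω ⟨0, by simp⟩)) :=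
    (measurable_of_countable f).comp (measurable_pi_apply _)
  have h := Kernel.traj_map_frestrictLe_apply (X := fun _ => S) (κ := fun n =>
    (chainKernel K).comap (fun x : (i : Finset.Iic n) → S => x ⟨n, Finset.mem_Iic.2 le_rfl⟩)
      (measurable_pi_apply _)) 0 0 (fun _ => z)
  rw [Kernel.partialTraj_self] at h
  have h2 := congrArg (fun ν => ∫ ω, f (ω ⟨0, by simp⟩) ∂ν) h
  rw [integral_map (by fun_prop) hm.aestronglyMeasurable, Kernel.id_apply,
    integral_dirac _ _] at h2
  exact h2

/-- The Markov property: conditioning the step `n → n + 1` on the path up to time `n`. -/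
theorem integral_chainLaw_succ (K : S → S → ℝ) (z : S) (n : ℕ) (A : Set ((i : Finset.Iic n) → S))
    (hA : MeasurableSet A) {f : S → ℝ} {c : ℝ} (hf : ∀ w, |f w| ≤ c) :
    ∫ ω, (Preorder.frestrictLe (π := fun _ => S) n ⁻¹' A).indicator (fun ω => f (ω (n + 1))) ω
        ∂chainLaw K z =
      ∫ ω, (Preorder.frestrictLe (π := fun _ => S) n ⁻¹' A).indicator
        (fun ω => ∫ y, f y ∂chainKernel K (ω n)) ω ∂chainLaw K z := by
  set κ : (n : ℕ) → Kernel ((i : Finset.Iic n) → S) S := fun n =>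
    (chainKernel K).comap (fun x : (i : Finset.Iic n) → S => x ⟨n, Finset.mem_Iic.2 le_rfl⟩)
      (measurable_pi_apply _) with hκ
  have hfm : Measurable f := measurable_of_countable f
  -- The integrand as a function of the pair (past, next state), whose law is a composition-product
  -- with the one-step kernel.
  set φ : ((i : Finset.Iic n) → S) × S → ℝ := (A ×ˢ Set.univ).indicator fun p => f p.2 with hφ
  have hφm : Measurable φ := (hfm.comp measurable_snd).indicator (hA.prod .univ)
  have hφb : ∀ p, ‖φ p‖ ≤ c := fun p => (norm_indicator_le_norm_self _ p).trans (hf p.2)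
  have key := Kernel.partialTraj_compProd_eq_map_traj (X := fun _ => S) (κ := κ)
    (zero_le (a := n)) (x₀ := fun _ => z)
  rw [← Kernel.traj_map_frestrictLe_apply] at key
  have e1 : ∫ p, φ p ∂((Kernel.traj (X := fun _ => S) κ 0 (fun _ => z)).map
      (fun x => (Preorder.frestrictLe n x, x (n + 1)))) =
      ∫ ω, (Preorder.frestrictLe (π := fun _ => S) n ⁻¹' A).indicator (fun ω => f (ω (n + 1))) ω
        ∂chainLaw K z := by
    rw [integral_map (by fun_prop) hφm.aestronglyMeasurable]
    refine integral_congr_ae (.of_forall fun ω => ?_)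
    by_cases h : Preorder.frestrictLe (π := fun _ => S) n ω ∈ A <;>
      simp [hφ, h]
  rw [← e1, ← key, Measure.integral_compProd
    (Integrable.of_bound hφm.aestronglyMeasurable c (.of_forall hφb)),
    integral_map (by fun_prop)
      (StronglyMeasurable.integral_kernel_prod_right' hφm.stronglyMeasurable).aestronglyMeasurable]
  refine integral_congr_ae (.of_forall fun ω => ?_)
  by_cases h : Preorder.frestrictLe (π := fun _ => S) n ω ∈ A
  · simp only [Set.mem_preimage, h, Set.indicator_of_mem, hφ, Set.indicator, Set.mem_prod,
      Set.mem_univ, and_true, if_true, hκ, Kernel.comap_apply]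
    rfl
  · simp [h, hφ]

/-- Expectations of the killed chain are iterates of the killed transition operator. -/
theorem integral_chainLaw_killed (K : S → S → ℝ) (B : Set S) (n : ℕ) {f : S → ℝ} {c : ℝ}
    (hf : ∀ w, |f w| ≤ c) (z : S) :
    ∫ ω, {ω : ℕ → S | ∀ i, 1 ≤ i → i ≤ n → ω i ∈ B}.indicator (fun ω => f (ω n)) ω
      ∂chainLaw K z = (killedOp K B)^[n] f z := by
  induction n generalizing f with
  | zero =>
    have : {ω : ℕ → S | ∀ i, 1 ≤ i → i ≤ 0 → ω i ∈ B} = Set.univ := by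
      ext; simp only [Set.mem_ofPred_eq, Set.mem_univ, iff_true]; intros; omega
    simp only [this, Set.indicator_univ]
    exact integral_chainLaw_zero K f z
  | succ n ih =>
    -- Time `0` is left unconstrained, so the starting point may lie outside `B`, as boundary states
    -- do.
    set A : Set ((i : Finset.Iic n) → S) := {x | ∀ i, 1 ≤ i.1 → x i ∈ B}
    have hA : MeasurableSet A := by
      simp only [A, Set.ofPred_forall]
      refine .iInter fun i => .iInter fun _ => measurable_pi_apply i B.to_countable.measurableSet
    have hpre : Preorder.frestrictLe (π := fun _ => S) n ⁻¹' A =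
        {ω : ℕ → S | ∀ i, 1 ≤ i → i ≤ n → ω i ∈ B} := by
      ext ω
      simp only [A, Set.mem_preimage, Set.mem_ofPred_eq, Preorder.frestrictLe_apply]
      exact ⟨fun h i h1 h2 => h ⟨i, Finset.mem_Iic.2 h2⟩ h1,
        fun h i h1 => h i h1 (Finset.mem_Iic.1 i.2)⟩
    rw [Function.iterate_succ_apply, ← ih (abs_killedOp_le K B hf)]
    have := integral_chainLaw_succ K z n A hA (f := B.indicator f) (c := c)
      (fun w => (norm_indicator_le_norm_self f w).trans (hf w))
    rw [hpre] at this
    refine Eq.trans ?_ this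
    refine integral_congr_ae (.of_forall fun ω => ?_)
    have hs : (∀ i, 1 ≤ i → i ≤ n + 1 → ω i ∈ B) ↔
        (∀ i, 1 ≤ i → i ≤ n → ω i ∈ B) ∧ ω (n + 1) ∈ B := by
      refine ⟨fun h => ⟨fun i h1 h2 => h i h1 (by omega), h _ (by omega) le_rfl⟩, fun h i h1 h2 => ?_⟩
      rcases Nat.le_succ_iff.1 h2 with h3 | rfl
      · exact h.1 i h1 h3
      · exact h.2
    by_cases h1 : ω ∈ {ω : ℕ → S | ∀ i, 1 ≤ i → i ≤ n → ω i ∈ B}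
    · rw [Set.indicator_of_mem h1]
      by_cases h2 : ω (n + 1) ∈ B
      · rw [Set.indicator_of_mem h2, Set.indicator_of_mem]
        exact hs.2 ⟨h1, h2⟩
      · rw [Set.indicator_of_notMem h2, Set.indicator_of_notMem]
        exact fun h => h2 (hs.1 h).2
    · rw [Set.indicator_of_notMem h1, Set.indicator_of_notMem]
      exact fun h => h1 (hs.1 h).1

/-- The probability of staying in `B` at all times `n ≥ 1` is the limit of the iterates of the
killed transition operator applied to the constant `1`. -/
theorem tendsto_killedOp_iterate (K : S → S → ℝ) (B : Set S) (z : S) :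
    Tendsto (fun n => (killedOp K B)^[n] (fun _ => 1) z) atTop
      (𝓝 ((chainLaw K z).real {ω | ∀ n, 1 ≤ n → ω n ∈ B})) := by
  set A : ℕ → Set (ℕ → S) := fun n => {ω | ∀ i, 1 ≤ i → i ≤ n → ω i ∈ B} with hAdef
  have hA : ∀ n, MeasurableSet (A n) := by
    intro n
    simp only [hAdef, Set.ofPred_forall]
    exact .iInter fun i => .iInter fun _ => .iInter fun _ =>
      measurable_pi_apply i B.to_countable.measurableSet
  have hI : {ω : ℕ → S | ∀ n, 1 ≤ n → ω n ∈ B} = ⋂ n, A n := by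
    ext ω
    simp only [hAdef, Set.mem_ofPred_eq, Set.mem_iInter]
    exact ⟨fun h _ i h1 _ => h i h1, fun h n h1 => h n n h1 le_rfl⟩
  have hanti : Antitone A := fun m n hmn ω hω i h1 h2 => hω i h1 (h2.trans hmn)
  have ht := tendsto_measure_iInter_atTop (μ := chainLaw K z)
    (fun n => (hA n).nullMeasurableSet) hanti ⟨0, measure_ne_top _ _⟩
  rw [hI]
  refine ((ENNReal.tendsto_toReal (measure_ne_top _ _)).comp ht).congr fun n => ?_
  rw [← integral_chainLaw_killed K B n (c := 1) (by simp) z]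
  exact (integral_indicator_one (hA n)).symm

end Chain

/-! ### The stationary distribution in closed recursive form. -/

section Stationary

instance : Fintype Status := ⟨{.up, .down}, fun x => by cases x <;> simp⟩

theorem sum_status (f : Status → ℝ) : ∑ σ, f σ = f .up + f .down :=
  Finset.sum_pair (by simp)

theorem tsum_mul_intensity_zero_up (r : Rates) (f : ℕ × Status → ℝ) :
    ∑' w, f w * intensity r w (0, .up) = f (1, .up) * r.mu + f (0, .down) * r.beta := by
  rw [tsum_eq_sum (s := {(1, .up), (0, .down)})]
  · rw [Finset.sum_pair (by simp)]
    simp [intensity]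
  · rintro ⟨y, τ⟩ h
    cases τ <;> simp [intensity] at h ⊢ <;> grind

theorem tsum_mul_intensity_zero_down (r : Rates) (f : ℕ × Status → ℝ) :
    ∑' w, f w * intensity r w (0, .down) = f (0, .up) * r.alpha := by
  rw [tsum_eq_sum (s := {(0, .up)})]
  · simp [intensity]
  · rintro ⟨y, τ⟩ h
    cases τ <;> simp [intensity] at h ⊢
    grind

theorem tsum_mul_intensity_succ_up (r : Rates) (f : ℕ × Status → ℝ) (k : ℕ) :
    ∑' w, f w * intensity r w (k + 1, .up) =
      f (k, .up) * r.lam + f (k + 2, .up) * r.mu + f (k + 1, .down) * r.beta := by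
  rw [tsum_eq_sum (s := {(k, .up), (k + 2, .up), (k + 1, .down)})]
  · rw [Finset.sum_insert (by simp), Finset.sum_pair (by simp)]
    simp [intensity, add_assoc]
  · rintro ⟨y, τ⟩ h
    cases τ <;> simp [intensity] at h ⊢ <;> grind

theorem tsum_mul_intensity_succ_down (r : Rates) (f : ℕ × Status → ℝ) (k : ℕ) :
    ∑' w, f w * intensity r w (k + 1, .down) =
      f (k, .down) * r.lam + f (k + 1, .up) * r.alpha := by
  rw [tsum_eq_sum (s := {(k, .down), (k + 1, .up)})]
  · rw [Finset.sum_pair (by simp)]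
    simp [intensity]
  · rintro ⟨y, τ⟩ h
    cases τ <;> simp [intensity] at h ⊢ <;> grind

theorem tsum_intensity_zero_up (r : Rates) :
    ∑' w, intensity r (0, .up) w = r.lam + r.alpha := by
  rw [tsum_eq_sum (s := {(1, .up), (0, .down)})]
  · rw [Finset.sum_pair (by simp)]
    simp [intensity]
  · rintro ⟨y, τ⟩ h
    cases τ <;> simp [intensity] at h ⊢ <;> grind

theorem tsum_intensity_succ_up (r : Rates) (k : ℕ) :
    ∑' w, intensity r (k + 1, .up) w = r.lam + r.mu + r.alpha := by
  rw [tsum_eq_sum (s := {(k + 2, .up), (k, .up), (k + 1, .down)})]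
  · rw [Finset.sum_insert (by simp), Finset.sum_pair (by simp)]
    simp [intensity, add_assoc]
  · rintro ⟨y, τ⟩ h
    cases τ <;> simp [intensity] at h ⊢ <;> grind

theorem tsum_intensity_down (r : Rates) (k : ℕ) :
    ∑' w, intensity r (k, .down) w = r.lam + r.beta := by
  rw [tsum_eq_sum (s := {(k + 1, .down), (k, .up)})]
  · rw [Finset.sum_pair (by simp)]
    simp [intensity]
  · rintro ⟨y, τ⟩ h
    cases τ <;> simp [intensity] at h ⊢ <;> grind

/-- The solution of the balance equations that takes the value `1` at `(0, Up)`: the values at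
`(k, Up)` and `(k, Down)`. -/
def balanceSol (r : Rates) : ℕ → ℝ × ℝ
  | 0 => (1, r.alpha / (r.lam + r.beta))
  | k + 1 =>
    (r.lam / r.mu * ((balanceSol r k).1 + (balanceSol r k).2),
      (r.lam * (balanceSol r k).2 +
        r.alpha * (r.lam / r.mu * ((balanceSol r k).1 + (balanceSol r k).2))) / (r.lam + r.beta))

/-- The candidate for the stationary distribution, with the value `c` at `(0, Up)`. -/
def balanceDist (r : Rates) (c : ℝ) : ℕ × Status → ℝ
  | (k, .up) => c * (balanceSol r k).1
  | (k, .down) => c * (balanceSol r k).2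

/-- The stationary probability of `(0, Up)`. -/
def emptyProb (r : Rates) : ℝ := r.beta / (r.alpha + r.beta) - r.lam / r.mu

variable {r : Rates}

theorem balanceSol_nonneg (hl : 0 < r.lam) (hm : 0 < r.mu) (ha : 0 < r.alpha) (hb : 0 < r.beta)
    (k : ℕ) : 0 ≤ (balanceSol r k).1 ∧ 0 ≤ (balanceSol r k).2 := by
  induction k with
  | zero => simp only [balanceSol]; constructor <;> positivity
  | succ k ih =>
    obtain ⟨h1, h2⟩ := ih
    simp only [balanceSol]; constructor <;> positivity

theorem emptyProb_pos (hm : 0 < r.mu) (ha : 0 < r.alpha) (hb : 0 < r.beta)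
    (hs : r.lam * (r.alpha + r.beta) < r.beta * r.mu) : 0 < emptyProb r := by
  unfold emptyProb
  rw [sub_pos, div_lt_div_iff₀ hm (by positivity)]
  exact hs

/-- A telescoping identity: the combination subtracted on the right is `1` at `n = 0` and drops by
exactly `emptyProb r` times the mass of level `n` at each step. -/
theorem sum_balanceSol (hl : 0 < r.lam) (hm : 0 < r.mu) (ha : 0 < r.alpha) (hb : 0 < r.beta)
    (n : ℕ) :
    emptyProb r * ∑ k ∈ Finset.range n, ((balanceSol r k).1 + (balanceSol r k).2) =
      1 - r.beta / (r.alpha + r.beta) *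
        ((balanceSol r n).1 + (r.lam + r.beta) / r.beta * (balanceSol r n).2) := by
  induction n with
  | zero => simp only [balanceSol, Finset.range_zero, Finset.sum_empty]; field_simp; ring
  | succ n ih =>
    rw [Finset.sum_range_succ, mul_add, ih]
    simp only [balanceSol, emptyProb]
    field_simp
    ring

/-- The telescoping identity is used twice: dropping its nonnegative remainder bounds the partial
sums; summability then sends the remainder to zero, which identifies the sum. -/
theorem hasSum_balanceSol (hl : 0 < r.lam) (hm : 0 < r.mu) (ha : 0 < r.alpha) (hb : 0 < r.beta)
    (hs : r.lam * (r.alpha + r.beta) < r.beta * r.mu) :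
    HasSum (fun k => (balanceSol r k).1 + (balanceSol r k).2) (emptyProb r)⁻¹ := by
  have hc := emptyProb_pos hm ha hb hs
  have hnn := balanceSol_nonneg hl hm ha hb
  have hsum : Summable fun k => (balanceSol r k).1 + (balanceSol r k).2 := by
    refine summable_of_sum_range_le (c := (emptyProb r)⁻¹)
      (fun k => add_nonneg (hnn k).1 (hnn k).2) fun n => ?_
    rw [← mul_le_mul_iff_right₀ hc, sum_balanceSol hl hm ha hb, mul_inv_cancel₀ hc.ne']
    have h1 := (hnn n).1
    have h2 := (hnn n).2
    have : 0 ≤ r.beta / (r.alpha + r.beta) *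
        ((balanceSol r n).1 + (r.lam + r.beta) / r.beta * (balanceSol r n).2) := by positivity
    linarith
  have h0 := hsum.tendsto_atTop_zero
  have h1 : Tendsto (fun k => (balanceSol r k).1) atTop (𝓝 0) :=
    squeeze_zero (fun k => (hnn k).1) (fun k => by have := (hnn k).2; linarith) h0
  have h2 : Tendsto (fun k => (balanceSol r k).2) atTop (𝓝 0) :=
    squeeze_zero (fun k => (hnn k).2) (fun k => by have := (hnn k).1; linarith) h0
  have h3 := hsum.hasSum.tendsto_sum_nat.const_mul (emptyProb r)
  simp only [sum_balanceSol hl hm ha hb] at h3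
  have h4 := ((h1.add (h2.const_mul ((r.lam + r.beta) / r.beta))).const_mul
    (r.beta / (r.alpha + r.beta))).const_sub 1
  have h5 := tendsto_nhds_unique h3 h4
  simp only [mul_zero, add_zero, sub_zero] at h5
  rw [← eq_inv_of_mul_eq_one_right h5]
  exact hsum.hasSum

theorem isStationary_balanceDist (hl : 0 < r.lam) (hm : 0 < r.mu) (ha : 0 < r.alpha)
    (hb : 0 < r.beta) (hs : r.lam * (r.alpha + r.beta) < r.beta * r.mu) :
    IsStationary r (balanceDist r (emptyProb r)) := by
  have hc := emptyProb_pos hm ha hb hs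
  have hnn := balanceSol_nonneg hl hm ha hb
  have h0 : ∀ z, 0 ≤ balanceDist r (emptyProb r) z := by
    rintro ⟨k, _ | _⟩
    · exact mul_nonneg hc.le (hnn k).1
    · exact mul_nonneg hc.le (hnn k).2
  have hrow : ∀ k, ∑' σ, balanceDist r (emptyProb r) (k, σ) =
      emptyProb r * ((balanceSol r k).1 + (balanceSol r k).2) := fun k => by
    rw [tsum_fintype, sum_status, mul_add]; rfl
  have hk := (hasSum_balanceSol hl hm ha hb hs).mul_left (emptyProb r)
  rw [mul_inv_cancel₀ hc.ne'] at hk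
  refine ⟨h0, ?_, ?_⟩
  · have hsum : Summable (balanceDist r (emptyProb r)) := by
      rw [summable_prod_of_nonneg h0]
      refine ⟨fun k => (hasSum_fintype _).summable, ?_⟩
      simp only [hrow]
      exact hk.summable
    have := hsum.tsum_prod
    simp only [hrow, hk.tsum_eq] at this
    rw [← this]
    exact hsum.hasSum
  · rintro ⟨_ | k, _ | _⟩
    · rw [tsum_mul_intensity_zero_up, tsum_intensity_zero_up]
      simp only [balanceDist, balanceSol]
      field_simp
      ring
    · rw [tsum_mul_intensity_zero_down, tsum_intensity_down]
      simp only [balanceDist, balanceSol]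
      field_simp
    · rw [tsum_mul_intensity_succ_up, tsum_intensity_succ_up]
      simp only [balanceDist, balanceSol]
      field_simp
      ring
    · rw [tsum_mul_intensity_succ_down, tsum_intensity_down]
      simp only [balanceDist, balanceSol]
      field_simp

theorem IsStationary.eq_balanceDist (hl : 0 < r.lam) (hm : 0 < r.mu) (ha : 0 < r.alpha)
    (hb : 0 < r.beta) (hs : r.lam * (r.alpha + r.beta) < r.beta * r.mu) {p : ℕ × Status → ℝ}
    (hp : IsStationary r p) : p = balanceDist r (emptyProb r) := by
  obtain ⟨-, hp1, hbal⟩ := hp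
  -- The third conjunct is the cut equation between levels `k` and `k + 1`. It is carried along
  -- because it determines `p (k + 1, .up)` from level `k` alone.
  have key : ∀ k, p (k, .up) = p (0, .up) * (balanceSol r k).1 ∧
      p (k, .down) = p (0, .up) * (balanceSol r k).2 ∧
      r.mu * p (k + 1, .up) = r.lam * (p (k, .up) + p (k, .down)) := by
    intro k
    induction k with
    | zero =>
      have e1 := hbal (0, .up)
      have e2 := hbal (0, .down)
      rw [tsum_mul_intensity_zero_up, tsum_intensity_zero_up] at e1
      rw [tsum_mul_intensity_zero_down, tsum_intensity_down] at e2
      refine ⟨by simp [balanceSol], ?_, ?_⟩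
      · simp only [balanceSol]
        field_simp
        linarith
      · simp only [zero_add]
        linarith
    | succ k ih =>
      obtain ⟨i1, i2, i3⟩ := ih
      have e1 := hbal (k + 1, .up)
      have e2 := hbal (k + 1, .down)
      rw [tsum_mul_intensity_succ_up, tsum_intensity_succ_up] at e1
      rw [tsum_mul_intensity_succ_down, tsum_intensity_down] at e2
      have h1 : p (k + 1, .up) = p (0, .up) * (balanceSol r (k + 1)).1 := by
        rw [i1, i2] at i3
        simp only [balanceSol]
        field_simp
        linarith
      have h2 : p (k + 1, .down) = p (0, .up) * (balanceSol r (k + 1)).2 := by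
        have : (balanceSol r (k + 1)).2 =
          (r.lam * (balanceSol r k).2 + r.alpha * (balanceSol r (k + 1)).1) /
            (r.lam + r.beta) := rfl
        rw [this, mul_div_assoc', eq_div_iff (by positivity), ← e2, h1, i2]
        ring
      refine ⟨h1, h2, ?_⟩
      rw [show k + 1 + 1 = k + 2 from rfl]
      linarith
  have hc := emptyProb_pos hm ha hb hs
  have hs1 : HasSum (fun k => p (k, .up) + p (k, .down)) 1 :=
    hp1.prod_fiberwise fun k => by
      rw [← sum_status fun σ => p (k, σ)]; exact hasSum_fintype _
  have hs2 := (hasSum_balanceSol hl hm ha hb hs).mul_left (p (0, .up))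
  have hfun : (fun k => p (k, .up) + p (k, .down)) = fun k =>
      p (0, .up) * ((balanceSol r k).1 + (balanceSol r k).2) := by
    funext k
    rw [(key k).1, (key k).2.1, mul_add]
  rw [hfun] at hs1
  have h0 : p (0, .up) = emptyProb r := by
    have := hs1.unique hs2
    field_simp at this
    exact this.symm
  funext ⟨k, σ⟩
  cases σ
  · rw [(key k).1, h0]; rfl
  · rw [(key k).2.1, h0]; rfl

theorem stationaryDist_eq (hl : 0 < r.lam) (hm : 0 < r.mu) (ha : 0 < r.alpha)
    (hb : 0 < r.beta) (hs : r.lam * (r.alpha + r.beta) < r.beta * r.mu) :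
    stationaryDist r = balanceDist r (emptyProb r) := by
  have h : ∃ p, IsStationary r p := ⟨_, isStationary_balanceDist hl hm ha hb hs⟩
  rw [stationaryDist, dif_pos h]
  exact h.choose_spec.eq_balanceDist hl hm ha hb hs

end Stationary

/-! ### Limits of the stationary distribution as `α ↓ 0`. -/

section Limits

variable {lam mu beta : ℝ}

theorem tendsto_emptyProb (hb : 0 < beta) :
    Tendsto (fun α => emptyProb ⟨lam, mu, α, beta⟩) (𝓝[>] 0) (𝓝 (1 - lam / mu)) := by
  have : ContinuousAt (fun α : ℝ => emptyProb ⟨lam, mu, α, beta⟩) 0 := by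
    unfold emptyProb
    refine ContinuousAt.sub (ContinuousAt.div ?_ ?_ ?_) ?_ <;>
      first | exact continuousAt_const | fun_prop | simp [hb.ne']
  have h := this.tendsto.mono_left (nhdsWithin_le_nhds (s := Set.Ioi 0))
  simpa [emptyProb, hb.ne'] using h

theorem tendsto_balanceSol (k : ℕ) :
    Tendsto (fun α => (balanceSol ⟨lam, mu, α, beta⟩ k).1) (𝓝[>] 0) (𝓝 ((lam / mu) ^ k)) ∧
    Tendsto (fun α => (balanceSol ⟨lam, mu, α, beta⟩ k).2) (𝓝[>] 0) (𝓝 0) := by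
  have hid : Tendsto (fun α : ℝ => α) (𝓝[>] 0) (𝓝 0) := nhdsWithin_le_nhds
  induction k with
  | zero =>
    simp only [balanceSol, pow_zero]
    exact ⟨tendsto_const_nhds, by simpa using hid.div_const (lam + beta)⟩
  | succ k ih =>
    have h1 := (ih.1.add ih.2).const_mul (lam / mu)
    have h2 := ((ih.2.const_mul lam).add (hid.mul h1)).div_const (lam + beta)
    simp only [balanceSol]
    refine ⟨?_, ?_⟩
    · rw [pow_succ', ← add_zero ((lam / mu) ^ k)]; exact h1
    · simpa using h2

end Limits

/-! ### The twisted free process and its escape probability. -/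

section Twisted

variable {r : Rates} {C : ℝ}

/-- The factor `h(x, Down) / h(x, Up)`. -/
def downFactor (r : Rates) : ℝ := 2 * r.beta / (r.lam + r.beta - r.mu - r.alpha + √(s r))

/-- Equivalent to `√s < beta + mu + alpha - lam`; the difference of the squares is `4 (beta mu - lam
(alpha + beta))`, so this is the stability condition. -/
theorem one_lt_inv_gamma (hl : 0 < r.lam) (ha : 0 < r.alpha) (hb : 0 < r.beta)
    (hs : r.lam * (r.alpha + r.beta) < r.beta * r.mu) : 1 < 1 / gamma r := by
  have hlm : r.lam < r.mu := by nlinarith [mul_pos hl ha]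
  have h : √(s r) < r.beta + r.mu + r.alpha - r.lam := by
    rw [Real.sqrt_lt' (by linarith)]
    unfold s
    nlinarith
  unfold gamma
  rw [one_div_div, one_lt_div (by positivity)]
  linarith

theorem sqrt_s_eq (hl : 0 < r.lam) :
    √(s r) = r.lam + r.beta + r.mu + r.alpha - 2 * r.lam * (1 / gamma r) := by
  unfold gamma; rw [one_div_div]; field_simp; ring

theorem lam_inv_gamma_lt (hl : 0 < r.lam) (ha : 0 < r.alpha) (hb : 0 < r.beta) :
    r.lam * (1 / gamma r) < r.lam + r.beta := by
  have : -(r.lam + r.beta - r.mu - r.alpha) < √(s r) := by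
    refine Real.lt_sqrt_of_sq_lt ?_
    unfold s
    nlinarith [mul_pos ha hl, mul_pos ha hb]
  linarith [sqrt_s_eq (r := r) hl]

/-- This is harmonicity of `h` at `(x, Down)`, rearranged. -/
theorem downFactor_mul (hl : 0 < r.lam) (ha : 0 < r.alpha) (hb : 0 < r.beta) :
    downFactor r * (r.lam + r.beta - r.lam * (1 / gamma r)) = r.beta := by
  have h := lam_inv_gamma_lt hl ha hb
  have h' : 0 < r.lam + r.beta - r.lam * (1 / gamma r) := by linarith
  have e : r.lam + r.beta - r.mu - r.alpha + √(s r) =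
      2 * (r.lam + r.beta - r.lam * (1 / gamma r)) := by rw [sqrt_s_eq hl]; ring
  rw [downFactor, e, mul_div_mul_left _ _ two_ne_zero, div_mul_cancel₀ _ h'.ne']

theorem one_lt_downFactor (hl : 0 < r.lam) (ha : 0 < r.alpha) (hb : 0 < r.beta)
    (hs : r.lam * (r.alpha + r.beta) < r.beta * r.mu) : 1 < downFactor r := by
  have h1 := downFactor_mul hl ha hb
  have h2 := lam_inv_gamma_lt hl ha hb
  have h3 := one_lt_inv_gamma hl ha hb hs
  nlinarith

/-- The functional equation that makes `h` harmonic at `(x, Up)`. -/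
theorem inv_gamma_harmonic (hl : 0 < r.lam) (hm : 0 < r.mu) (ha : 0 < r.alpha) (hb : 0 < r.beta)
    (hs : r.lam * (r.alpha + r.beta) < r.beta * r.mu) :
    r.lam * (1 / gamma r) + r.mu / (1 / gamma r) + r.alpha * downFactor r =
      r.alpha + r.mu + r.lam := by
  have hs0 : 0 ≤ s r := by unfold s; positivity
  have h1 := downFactor_mul hl ha hb
  have h2 := lam_inv_gamma_lt hl ha hb
  have h3 := one_lt_inv_gamma hl ha hb hs
  have hq := Real.sq_sqrt hs0
  rw [sqrt_s_eq hl] at hq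
  unfold s at hq
  set t := 1 / gamma r
  have ht : 0 < t := by linarith
  have hpos : 0 < r.lam + r.beta - r.lam * t := by linarith
  have hD : downFactor r = r.beta / (r.lam + r.beta - r.lam * t) := by
    rw [eq_div_iff hpos.ne']; exact h1
  have hne := hpos.ne'
  rw [hD]
  field_simp
  have hl' := hl.ne'
  -- The quadratic satisfied by `1 / gamma`, from squaring `√s`. The cleared harmonicity equation is
  -- a cubic that also has the root `t = 1`, since constants are harmonic; this explains the factor
  -- `1 - t` below.
  have e4 : r.lam * t ^ 2 * r.lam + r.mu * (r.lam + r.beta) =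
      r.lam * (r.beta + r.alpha + r.lam + r.mu) * t := by linarith
  linear_combination (1 - t) * e4

theorem harmonic_up (x : ℤ) : harmonic r (x, .up) = (1 / gamma r) ^ x := rfl

theorem harmonic_down (x : ℤ) : harmonic r (x, .down) = (1 / gamma r) ^ x * downFactor r := rfl

theorem integral_twistedKernel_up (hl : 0 < r.lam) (hm : 0 < r.mu) (ha : 0 < r.alpha)
    (hb : 0 < r.beta) (hs : r.lam * (r.alpha + r.beta) < r.beta * r.mu)
    (hC : r.lam + r.mu + r.alpha + r.beta ≤ C) {f : ℤ × Status → ℝ} {c : ℝ}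
    (hf : ∀ w, |f w| ≤ c) (x : ℤ) :
    ∫ y, f y ∂chainKernel (twistedKernel r C) (x, .up) =
      r.lam * (1 / gamma r) / C * f (x + 1, .up) + r.mu / (1 / gamma r) / C * f (x - 1, .up) +
      r.alpha * downFactor r / C * f (x, .down) +
      (1 - (r.alpha + r.mu + r.lam) / C) * f (x, .up) := by
  obtain ⟨h0, h1⟩ := twistedKernel_stochastic r C hl hm ha hb hC (x, .up)
  have ht : 0 < 1 / gamma r := by linarith [one_lt_inv_gamma hl ha hb hs]
  have hz := zpow_pos ht x
  rw [integral_chainKernel h0 h1 hf,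
    tsum_eq_sum (s := {(x + 1, .up), (x - 1, .up), (x, .down), (x, .up)})]
  · rw [Finset.sum_insert (by simp; omega), Finset.sum_insert (by simp),
      Finset.sum_pair (by simp)]
    simp only [twistedKernel, harmonic_up, harmonic_down, zpow_add_one₀ ht.ne',
      zpow_sub_one₀ ht.ne']
    set t := 1 / gamma r
    simp [freeKernel, show x - 1 ≠ x + 1 by omega, show x ≠ x - 1 by omega]
    field_simp
    ring
  · rintro ⟨y, τ⟩ h
    cases τ <;> simp [twistedKernel, freeKernel] at h ⊢ <;> grind

theorem integral_twistedKernel_down (hl : 0 < r.lam) (hm : 0 < r.mu) (ha : 0 < r.alpha)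
    (hb : 0 < r.beta) (hs : r.lam * (r.alpha + r.beta) < r.beta * r.mu)
    (hC : r.lam + r.mu + r.alpha + r.beta ≤ C) {f : ℤ × Status → ℝ} {c : ℝ}
    (hf : ∀ w, |f w| ≤ c) (x : ℤ) :
    ∫ y, f y ∂chainKernel (twistedKernel r C) (x, .down) =
      r.lam * (1 / gamma r) / C * f (x + 1, .down) + r.beta / downFactor r / C * f (x, .up) +
      (1 - (r.lam + r.beta) / C) * f (x, .down) := by
  obtain ⟨h0, h1⟩ := twistedKernel_stochastic r C hl hm ha hb hC (x, .down)
  have ht : 0 < 1 / gamma r := by linarith [one_lt_inv_gamma hl ha hb hs]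
  have hD : 0 < downFactor r := by linarith [one_lt_downFactor hl ha hb hs]
  have hz := zpow_pos ht x
  rw [integral_chainKernel h0 h1 hf,
    tsum_eq_sum (s := {(x + 1, .down), (x, .up), (x, .down)})]
  · rw [Finset.sum_insert (by simp), Finset.sum_pair (by simp)]
    simp only [twistedKernel, harmonic_up, harmonic_down, zpow_add_one₀ ht.ne']
    set t := 1 / gamma r
    simp [freeKernel]
    field_simp
    ring
  · rintro ⟨y, τ⟩ h
    cases τ <;> simp [twistedKernel, freeKernel] at h ⊢ <;> grind

/-- A maximum principle: a function on the interior that decays to the right and is dominated by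
an average of its right neighbour and its supremum is nonpositive. -/
theorem nonpos_of_right_average {e : ℤ × Status → ℝ} {t a : ℝ} (ht : 1 < t) (ha : 0 < a)
    (hdecay : ∀ z, 1 ≤ z.1 → e z ≤ t⁻¹ ^ z.1)
    (hstep : ∀ M, 0 ≤ M → (∀ z, 1 ≤ z.1 → e z ≤ M) → ∀ x σ, 1 ≤ x →
      e (x, σ) ≤ a * e (x + 1, σ) + (1 - a) * M)
    (z : ℤ × Status) (hz : 1 ≤ z.1) : e z ≤ 0 := by
  by_contra! hpos
  have hti : 0 < t⁻¹ := by positivity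
  have hti1 : t⁻¹ < 1 := inv_lt_one_of_one_lt₀ ht
  have hsmall : ∀ ε, 0 < ε → ∃ N : ℕ, ∀ z : ℤ × Status, 1 ≤ z.1 → (N : ℤ) ≤ z.1 → e z < ε := by
    intro ε hε
    obtain ⟨N, hN⟩ := exists_pow_lt_of_lt_one hε hti1
    refine ⟨N, fun z h1 h2 => ((hdecay z h1).trans ?_).trans_lt hN⟩
    rw [← zpow_natCast]
    exact zpow_le_zpow_right_of_le_one₀ hti hti1.le h2
  obtain ⟨N, hN⟩ := hsmall (e z) hpos
  have hmem : ∀ w : ℤ × Status, 1 ≤ w.1 → e z ≤ e w →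
      w ∈ Finset.Icc (1 : ℤ) N ×ˢ (Finset.univ : Finset Status) := by
    intro w h1 h2
    simp only [Finset.mem_product, Finset.mem_Icc, Finset.mem_univ, and_true]
    refine ⟨h1, ?_⟩
    by_contra! h
    exact (hN w h1 h.le).not_ge h2
  -- By decay, values at least `e z > 0` occur only in a finite strip, so the supremum over the
  -- interior is attained.
  obtain ⟨⟨x, σ⟩, hm1, hm2⟩ := Finset.exists_max_image _ e ⟨z, hmem z hz le_rfl⟩
  have hzm := hm2 z (hmem z hz le_rfl)
  have hmax : ∀ w : ℤ × Status, 1 ≤ w.1 → e w ≤ e (x, σ) := by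
    intro w h1
    by_cases h : e z ≤ e w
    · exact hm2 w (hmem w h1 h)
    · linarith
  simp only [Finset.mem_product, Finset.mem_Icc, Finset.mem_univ, and_true] at hm1
  -- A maximum bounded by an average of its right neighbour and itself is passed to that neighbour;
  -- repeated, this contradicts the decay.
  have hright : ∀ j : ℕ, e (x, σ) ≤ e (x + j, σ) := by
    intro j
    induction j with
    | zero => simp
    | succ j ih =>
      have h := hstep (e (x, σ)) (by linarith) hmax (x + j) σ (by omega)
      rw [Nat.cast_succ, ← add_assoc]
      have : a * e (x, σ) ≤ a * e (x + j + 1, σ) := by linarith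
      exact le_of_mul_le_mul_left this ha
  have := hN (x + N, σ) (by simp only; omega) (by simp only; omega)
  linarith [hright N]

/-- The set of interior states. -/
def interiorStates : Set (ℤ × Status) := {z | 1 ≤ z.1}

theorem tendsto_noReturnProb (z : ℤ × Status) :
    Tendsto (fun n => (killedOp (twistedKernel r C) interiorStates)^[n] (fun _ => 1) z) atTop
      (𝓝 (noReturnProb r C z)) :=
  tendsto_killedOp_iterate _ _ _

theorem noReturnProb_nonneg (z : ℤ × Status) : 0 ≤ noReturnProb r C z := measureReal_nonneg

theorem noReturnProb_le_one (z : ℤ × Status) : noReturnProb r C z ≤ 1 := measureReal_le_one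

theorem abs_noReturnProb_le_one (z : ℤ × Status) : |noReturnProb r C z| ≤ 1 := by
  rw [abs_of_nonneg (noReturnProb_nonneg z)]
  exact noReturnProb_le_one z

/-- The iterates and their shift by one have the same limit, and dominated convergence moves the
operator past the limit. -/
theorem killedOp_noReturnProb (z : ℤ × Status) :
    killedOp (twistedKernel r C) interiorStates (noReturnProb r C) z = noReturnProb r C z := by
  have h1 := (tendsto_noReturnProb (r := r) (C := C) z).comp (tendsto_add_atTop_nat 1)
  refine tendsto_nhds_unique ?_ h1
  simp only [Function.comp_def, Function.iterate_succ_apply']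
  have hb : ∀ n w, |(killedOp (twistedKernel r C) interiorStates)^[n] (fun _ => 1) w| ≤ 1 := by
    intro n
    induction n with
    | zero => simp
    | succ n ih =>
      simp only [Function.iterate_succ_apply']
      exact abs_killedOp_le _ _ ih
  change Tendsto (fun n => ∫ y, interiorStates.indicator
    ((killedOp (twistedKernel r C) interiorStates)^[n] (fun _ => 1)) y
      ∂chainKernel (twistedKernel r C) z) atTop
    (𝓝 (∫ y, interiorStates.indicator (noReturnProb r C) y ∂chainKernel (twistedKernel r C) z))
  refine tendsto_integral_of_dominated_convergence (fun _ => 1)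
    (fun n => (measurable_of_countable _).aestronglyMeasurable) (integrable_const _)
    (fun n => .of_forall fun w => (norm_indicator_le_norm_self _ w).trans (hb n w))
    (.of_forall fun w => ?_)
  by_cases hw : w ∈ interiorStates
  · simpa only [Set.indicator_of_mem hw] using tendsto_noReturnProb w
  · simp only [Set.indicator_of_notMem hw]
    exact tendsto_const_nhds

/-- The probability `1 - 1 / h` of never leaving the interior. -/
def escapeProb (r : Rates) (z : ℤ × Status) : ℝ := 1 - (harmonic r z)⁻¹

theorem one_le_harmonic (hl : 0 < r.lam) (ha : 0 < r.alpha) (hb : 0 < r.beta)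
    (hs : r.lam * (r.alpha + r.beta) < r.beta * r.mu) {z : ℤ × Status} (hz : 0 ≤ z.1) :
    (1 / gamma r) ^ z.1 ≤ harmonic r z ∧ 1 ≤ harmonic r z := by
  have ht := one_lt_inv_gamma hl ha hb hs
  have hD := one_lt_downFactor hl ha hb hs
  obtain ⟨x, σ⟩ := z
  have h1 : 1 ≤ (1 / gamma r) ^ x := one_le_zpow₀ ht.le hz
  cases σ
  · exact ⟨le_rfl, h1⟩
  · rw [harmonic_down]
    constructor <;> nlinarith

theorem indicator_escapeProb_mem_Icc (hl : 0 < r.lam) (ha : 0 < r.alpha)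
    (hb : 0 < r.beta) (hs : r.lam * (r.alpha + r.beta) < r.beta * r.mu) (z : ℤ × Status) :
    interiorStates.indicator (escapeProb r) z ∈ Set.Icc 0 1 := by
  by_cases hz : z ∈ interiorStates
  · rw [Set.indicator_of_mem hz]
    have h := (one_le_harmonic hl ha hb hs (show 0 ≤ z.1 from zero_le_one.trans hz)).2
    have h1 := inv_le_one_of_one_le₀ h
    have h2 : 0 < (harmonic r z)⁻¹ := by positivity
    unfold escapeProb
    constructor <;> linarith
  · rw [Set.indicator_of_notMem hz]; simp

theorem abs_indicator_escapeProb_le (hl : 0 < r.lam) (ha : 0 < r.alpha)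
    (hb : 0 < r.beta) (hs : r.lam * (r.alpha + r.beta) < r.beta * r.mu) (z : ℤ × Status) :
    |interiorStates.indicator (escapeProb r) z| ≤ 1 := by
  have := indicator_escapeProb_mem_Icc hl ha hb hs z
  rw [abs_of_nonneg this.1]
  exact this.2

/-- `1 - 1 / h` is harmonic for the twisted process killed outside of the interior. -/
theorem killedOp_escapeProb (hl : 0 < r.lam) (hm : 0 < r.mu) (ha : 0 < r.alpha)
    (hb : 0 < r.beta) (hs : r.lam * (r.alpha + r.beta) < r.beta * r.mu)
    (hC : r.lam + r.mu + r.alpha + r.beta ≤ C) {z : ℤ × Status} (hz : z ∈ interiorStates) :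
    killedOp (twistedKernel r C) interiorStates (escapeProb r) z = escapeProb r z := by
  have hbd := abs_indicator_escapeProb_le hl ha hb hs
  have ht := one_lt_inv_gamma hl ha hb hs
  have hD := one_lt_downFactor hl ha hb hs
  have h1 := downFactor_mul hl ha hb
  have h2 := inv_gamma_harmonic hl hm ha hb hs
  have hC0 : 0 < C := by linarith
  obtain ⟨x, σ⟩ := z
  have hx : 1 ≤ x := hz
  have hin : ∀ y τ, 1 ≤ y →
      interiorStates.indicator (escapeProb r) (y, τ) = escapeProb r (y, τ) :=
    fun y τ hy => Set.indicator_of_mem (show (y, τ) ∈ interiorStates from hy) _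
  -- The process can leave the interior only through `(0, Up)`, where `h = 1` and `1 - 1 / h`
  -- vanishes. Killing therefore changes nothing.
  have hleft : interiorStates.indicator (escapeProb r) (x - 1, .up) = escapeProb r (x - 1, .up) := by
    rcases hx.eq_or_lt with rfl | hx
    · rw [Set.indicator_of_notMem (by simp [interiorStates])]
      simp [escapeProb, harmonic]
    · exact hin _ _ (by omega)
  have ht0 : 0 < 1 / gamma r := by linarith
  have hzp := zpow_pos ht0 x
  cases σ
  · rw [killedOp, integral_twistedKernel_up hl hm ha hb hs hC hbd, hleft, hin _ _ hx, hin _ _ hx,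
      hin _ _ (by omega)]
    simp only [escapeProb, harmonic_up, harmonic_down, zpow_add_one₀ ht0.ne',
      zpow_sub_one₀ ht0.ne']
    generalize 1 / gamma r = t at *
    generalize downFactor r = D at *
    field_simp at h2 ⊢
    linear_combination (t ^ x) * h2
  · rw [killedOp, integral_twistedKernel_down hl hm ha hb hs hC hbd, hin _ _ hx, hin _ _ hx,
      hin _ _ (by omega)]
    simp only [escapeProb, harmonic_up, harmonic_down, zpow_add_one₀ ht0.ne']
    generalize 1 / gamma r = t at *
    generalize downFactor r = D at *
    field_simp
    linear_combination (-(t ^ x)) * h1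

/-- The fixed function `1 - 1 / h` is at most `1`, so by monotonicity it stays below every iterate
started from `1`. -/
theorem escapeProb_le_noReturnProb (hl : 0 < r.lam) (hm : 0 < r.mu) (ha : 0 < r.alpha)
    (hb : 0 < r.beta) (hs : r.lam * (r.alpha + r.beta) < r.beta * r.mu)
    (hC : r.lam + r.mu + r.alpha + r.beta ≤ C) {z : ℤ × Status} (hz : z ∈ interiorStates) :
    escapeProb r z ≤ noReturnProb r C z := by
  refine ge_of_tendsto' (tendsto_noReturnProb z) fun n => ?_
  have hbd : ∀ n w, |(killedOp (twistedKernel r C) interiorStates)^[n] (fun _ => 1) w| ≤ 1 := by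
    intro n
    induction n with
    | zero => simp
    | succ n ih =>
      simp only [Function.iterate_succ_apply']
      exact abs_killedOp_le _ _ ih
  induction n generalizing z with
  | zero =>
    have := (indicator_escapeProb_mem_Icc hl ha hb hs z).2
    rwa [Set.indicator_of_mem hz] at this
  | succ n ih =>
    rw [← killedOp_escapeProb hl hm ha hb hs hC hz, Function.iterate_succ_apply']
    exact killedOp_mono (abs_indicator_escapeProb_le hl ha hb hs)
      (abs_indicator_le (hbd n)) (fun w hw => ih hw) z

/-- For the upper bound, the difference of the two fixed functions is at most `1 / h`, which decays
geometrically to the right. Each step moves right with the same weight `lam (1 / gamma) / C` in both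
statuses, so `nonpos_of_right_average` applies. -/
theorem noReturnProb_eq_escapeProb (hl : 0 < r.lam) (hm : 0 < r.mu) (ha : 0 < r.alpha)
    (hb : 0 < r.beta) (hs : r.lam * (r.alpha + r.beta) < r.beta * r.mu)
    (hC : r.lam + r.mu + r.alpha + r.beta ≤ C) {z : ℤ × Status} (hz : z ∈ interiorStates) :
    noReturnProb r C z = escapeProb r z := by
  refine le_antisymm ?_ (escapeProb_le_noReturnProb hl hm ha hb hs hC hz)
  have ht := one_lt_inv_gamma hl ha hb hs
  have hD := one_lt_downFactor hl ha hb hs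
  have h2 := inv_gamma_harmonic hl hm ha hb hs
  have h1 := downFactor_mul hl ha hb
  have ht0 : 0 < 1 / gamma r := by linarith
  have hC0 : 0 < C := by linarith
  set e : ℤ × Status → ℝ := fun w => noReturnProb r C w - escapeProb r w with he
  set E : ℤ × Status → ℝ := fun w =>
    interiorStates.indicator (noReturnProb r C) w - interiorStates.indicator (escapeProb r) w with hE
  have hEe : ∀ w ∈ interiorStates, E w = e w := fun w hw => by
    simp only [hE, he, Set.indicator_of_mem hw]
  have hbU : ∀ w, |interiorStates.indicator (noReturnProb r C) w| ≤ 1 := 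
    abs_indicator_le abs_noReturnProb_le_one
  have hbG := abs_indicator_escapeProb_le hl ha hb hs
  have hfix : ∀ w ∈ interiorStates, e w =
      killedOp (twistedKernel r C) interiorStates (noReturnProb r C) w -
        killedOp (twistedKernel r C) interiorStates (escapeProb r) w := fun w hw => by
    rw [killedOp_noReturnProb, killedOp_escapeProb hl hm ha hb hs hC hw]
  suffices e z ≤ 0 by simp only [he] at this; linarith
  refine nonpos_of_right_average (a := r.lam * (1 / gamma r) / C) ht (by positivity)
    (fun w hw => ?_) (fun M hM hle x σ hx => ?_) z hz
  · have h := (one_le_harmonic hl ha hb hs (show 0 ≤ w.1 by omega)).1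
    have hp := zpow_pos ht0 w.1
    have := inv_anti₀ hp h
    have h3 := noReturnProb_le_one (r := r) (C := C) w
    rw [inv_zpow]
    simp only [he, escapeProb]
    linarith
  -- Outside the interior the killed difference is `0`, which is where `0 ≤ M` enters.
  · have hEM : ∀ w, E w ≤ M := fun w => by
      by_cases hw : w ∈ interiorStates
      · rw [hEe w hw]; exact hle w hw
      · simpa only [hE, Set.indicator_of_notMem hw, sub_zero] using hM
    have hxm : ∀ τ, (x, τ) ∈ interiorStates := fun τ => hx
    have hx1 : ∀ τ, (x + 1, τ) ∈ interiorStates := fun τ => by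
      change 1 ≤ x + 1; omega
    rw [hfix _ (hxm σ), ← hEe _ (hx1 σ)]
    cases σ
    · rw [killedOp, killedOp, integral_twistedKernel_up hl hm ha hb hs hC hbU,
        integral_twistedKernel_up hl hm ha hb hs hC hbG]
      have k1 : 0 ≤ r.mu / (1 / gamma r) / C := by positivity
      have k2 : 0 ≤ r.alpha * downFactor r / C := by positivity
      have k3 : 0 ≤ 1 - (r.alpha + r.mu + r.lam) / C := by
        rw [sub_nonneg, div_le_one hC0]; linarith
      -- The remaining weights of the row sum to one minus the right weight, by harmonicity of `h`.
      have k4 : r.mu / (1 / gamma r) / C + r.alpha * downFactor r / C +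
          (1 - (r.alpha + r.mu + r.lam) / C) = 1 - r.lam * (1 / gamma r) / C := by
        rw [← h2]; ring
      have m1 := mul_le_mul_of_nonneg_left (hEM (x - 1, .up)) k1
      have m2 := mul_le_mul_of_nonneg_left (hEM (x, .down)) k2
      have m3 := mul_le_mul_of_nonneg_left (hEM (x, .up)) k3
      rw [← k4]
      simp only [hE] at m1 m2 m3 ⊢
      linarith
    · rw [killedOp, killedOp, integral_twistedKernel_down hl hm ha hb hs hC hbU,
        integral_twistedKernel_down hl hm ha hb hs hC hbG]
      have k1 : 0 ≤ r.beta / downFactor r / C := by positivity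
      have k3 : 0 ≤ 1 - (r.lam + r.beta) / C := by
        rw [sub_nonneg, div_le_one hC0]; linarith
      have k4 : r.beta / downFactor r / C + (1 - (r.lam + r.beta) / C) =
          1 - r.lam * (1 / gamma r) / C := by
        have : r.beta / downFactor r = r.lam + r.beta - r.lam * (1 / gamma r) := by
          rw [div_eq_iff (by positivity)]; linear_combination -h1
        rw [this]; ring
      have m1 := mul_le_mul_of_nonneg_left (hEM (x, .up)) k1
      have m3 := mul_le_mul_of_nonneg_left (hEM (x, .down)) k3
      rw [← k4]
      simp only [hE] at m1 m3 ⊢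
      linarith

/-- From `(0, Up)` only an arrival enters the interior, and from `(1, Up)` the escape probability is
`1 - gamma`. -/
theorem noReturnProb_zero_up (hl : 0 < r.lam) (hm : 0 < r.mu) (ha : 0 < r.alpha)
    (hb : 0 < r.beta) (hs : r.lam * (r.alpha + r.beta) < r.beta * r.mu)
    (hC : r.lam + r.mu + r.alpha + r.beta ≤ C) :
    noReturnProb r C (0, .up) = r.lam * (1 / gamma r - 1) / C := by
  have ht := one_lt_inv_gamma hl ha hb hs
  have ht0 : 0 < 1 / gamma r := by linarith
  have h1 : ((1 : ℤ), Status.up) ∈ interiorStates := le_refl (1 : ℤ)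
  rw [← killedOp_noReturnProb, killedOp, integral_twistedKernel_up hl hm ha hb hs hC
    (abs_indicator_le abs_noReturnProb_le_one),
    zero_add, Set.indicator_of_mem h1, Set.indicator_of_notMem (by simp [interiorStates]),
    Set.indicator_of_notMem (by simp [interiorStates]),
    Set.indicator_of_notMem (by simp [interiorStates]),
    noReturnProb_eq_escapeProb hl hm ha hb hs hC h1, escapeProb, harmonic_up, zpow_one]
  generalize 1 / gamma r = t at *
  field_simp
  ring

end Twisted

/-! ### Limits of the constants as `α ↓ 0`. -/

section Limits

variable {lam mu beta : ℝ}

/-- At `α = 0` the discriminant is the square of `lam + beta - mu`, and the regime assumption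
selects this sign of the root. -/
theorem tendsto_sqrt_s (hregime : mu < lam + beta) :
    Tendsto (fun α => √(s ⟨lam, mu, α, beta⟩)) (𝓝[>] 0) (𝓝 (lam + beta - mu)) := by
  have : Continuous fun α => √(s ⟨lam, mu, α, beta⟩) := by unfold s; fun_prop
  have h := (this.tendsto 0).mono_left (nhdsWithin_le_nhds (s := Set.Ioi 0))
  convert h using 2
  rw [eq_comm, Real.sqrt_eq_iff_eq_sq (by unfold s; simp; positivity) (by linarith)]
  unfold s
  ring

theorem tendsto_gamma (hm : 0 < mu) (hregime : mu < lam + beta) :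
    Tendsto (fun α => gamma ⟨lam, mu, α, beta⟩) (𝓝[>] 0) (𝓝 (lam / mu)) := by
  have hid : Tendsto (fun α : ℝ => α) (𝓝[>] 0) (𝓝 0) := nhdsWithin_le_nhds
  have h := (tendsto_const_nhds (x := 2 * lam)).div
    ((hid.const_add (lam + beta + mu)).sub (tendsto_sqrt_s hregime)) (by linarith)
  rw [show lam + beta + mu + 0 - (lam + beta - mu) = 2 * mu by ring,
    mul_div_mul_left _ _ two_ne_zero] at h
  exact h

theorem tendsto_omega (hregime : mu < lam + beta) :
    Tendsto (fun α => lam + beta - mu - α + √(s ⟨lam, mu, α, beta⟩)) (𝓝[>] 0)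
      (𝓝 (2 * (lam + beta - mu))) := by
  have hid : Tendsto (fun α : ℝ => α) (𝓝[>] 0) (𝓝 0) := nhdsWithin_le_nhds
  convert (hid.const_sub (lam + beta - mu)).add (tendsto_sqrt_s hregime) using 2
  ring

theorem tendsto_G (hregime : mu < lam + beta) :
    Tendsto (fun α => G ⟨lam, mu, α, beta⟩) (𝓝[>] 0) (𝓝 (lam + beta - mu)) := by
  have hid : Tendsto (fun α : ℝ => α) (𝓝[>] 0) (𝓝 0) := nhdsWithin_le_nhds
  have hω := tendsto_omega hregime
  have h := (hω.div_const 2).add (((hid.const_mul 2).mul_const beta).div hω (by linarith))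
  rw [mul_div_cancel_left₀ _ two_ne_zero, mul_zero, zero_mul, zero_div, add_zero] at h
  exact h

theorem tendsto_drift {C : ℝ} (hm : 0 < mu) (hregime : mu < lam + beta) :
    Tendsto (fun α => drift ⟨lam, mu, α, beta⟩ C) (𝓝[>] 0) (𝓝 ((mu - lam) / C)) := by
  have hid : Tendsto (fun α : ℝ => α) (𝓝[>] 0) (𝓝 0) := nhdsWithin_le_nhds
  have hω := tendsto_omega hregime
  have hG := tendsto_G hregime
  have hden := (hid.const_add (lam + beta + mu)).sub (tendsto_sqrt_s hregime)
  have hb : 0 < lam + beta - mu := by linarith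
  have h := ((hden.div_const 2).sub ((((tendsto_const_nhds (x := (1 : ℝ))).div hG
    hb.ne').mul_const (lam * mu)).mul (hω.div hden (by linarith)))).const_mul (1 / C)
  have e : 1 / C * ((lam + beta + mu + 0 - (lam + beta - mu)) / 2 - 1 / (lam + beta - mu) *
      (lam * mu) * (2 * (lam + beta - mu) / (lam + beta + mu + 0 - (lam + beta - mu)))) =
      (mu - lam) / C := by
    rw [show lam + beta + mu + 0 - (lam + beta - mu) = 2 * mu by ring]
    field_simp
  rw [e] at h
  exact h

theorem eta_eq {r : Rates} {C : ℝ} (hl : 0 < r.lam) (hm : 0 < r.mu) (ha : 0 < r.alpha)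
    (hb : 0 < r.beta) (hs : r.lam * (r.alpha + r.beta) < r.beta * r.mu)
    (hC : r.lam + r.mu + r.alpha + r.beta ≤ C) :
    eta r C = emptyProb r * (r.lam * (1 / gamma r - 1) / C) +
      emptyProb r * (balanceSol r 0).2 * downFactor r * noReturnProb r C (0, .down) := by
  simp [eta, stationaryDist_eq hl hm ha hb hs, noReturnProb_zero_up hl hm ha hb hs hC,
    harmonic_up, harmonic_down, balanceDist, balanceSol]

variable {C α₀ : ℝ}

theorem tendsto_eta (hl : 0 < lam) (hm : 0 < mu) (hb : 0 < beta) (hα₀ : 0 < α₀)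
    (hregime : mu < lam + beta) (hC : lam + mu + α₀ + beta ≤ C)
    (hs : ∀ α, 0 < α → α ≤ α₀ → lam * (α + beta) < beta * mu) :
    Tendsto (fun α => eta ⟨lam, mu, α, beta⟩ C) (𝓝[>] 0)
      (𝓝 ((1 - lam / mu) * ((mu - lam) / C))) := by
  have hγ := tendsto_gamma hm hregime
  have hp := tendsto_emptyProb (lam := lam) (mu := mu) hb
  have hq := (tendsto_balanceSol (lam := lam) (mu := mu) (beta := beta) 0).2
  have hD : Tendsto (fun α => downFactor ⟨lam, mu, α, beta⟩) (𝓝[>] 0)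
      (𝓝 (2 * beta / (2 * (lam + beta - mu)))) :=
    tendsto_const_nhds.div (tendsto_omega hregime) (by linarith)
  have h1 := hp.mul ((((tendsto_const_nhds (x := (1 : ℝ))).div hγ (by positivity)).sub_const
    1).const_mul lam |>.div_const C)
  have h2 : Tendsto (fun α => emptyProb ⟨lam, mu, α, beta⟩ * (balanceSol ⟨lam, mu, α, beta⟩ 0).2 *
      downFactor ⟨lam, mu, α, beta⟩ * noReturnProb ⟨lam, mu, α, beta⟩ C (0, .down))
      (𝓝[>] 0) (𝓝 0) := by
    have h0 := (hp.mul hq).mul hD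
    rw [mul_zero, zero_mul] at h0
    -- The prefactor vanishes with the mass of `(0, Down)`, so boundedness of the escape probability
    -- suffices.
    refine h0.zero_mul_isBoundedUnder_le
      (isBoundedUnder_of ⟨1, fun α => abs_noReturnProb_le_one _⟩)
  have h3 := h1.add h2
  rw [add_zero] at h3
  have e : lam * (1 / (lam / mu) - 1) / C = (mu - lam) / C := by field_simp
  rw [e] at h3
  refine h3.congr' ?_
  filter_upwards [Ioc_mem_nhdsGT hα₀] with α hα
  exact (eta_eq hl hm hα.1 hb (hs α hα.1 hα.2) (by linarith [hα.2])).symm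

theorem tendsto_constUp {e : ℝ} (hlm : lam < mu) (hm : 0 < mu) (hregime : mu < lam + beta)
    (hC : 0 < C) (he : Tendsto (fun α => eta ⟨lam, mu, α, beta⟩ C) (𝓝[>] 0) (𝓝 e)) :
    Tendsto (fun α => constUp ⟨lam, mu, α, beta⟩ C) (𝓝[>] 0) (𝓝 (e * C / (mu - lam))) := by
  have hb : 0 < lam + beta - mu := by linarith
  have hd : 0 < mu - lam := by linarith
  have h := ((he.div (tendsto_drift (C := C) hm hregime) (by positivity)).mul
    ((tendsto_const_nhds (x := (1 : ℝ))).div (tendsto_G hregime) hb.ne')).mul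
    ((tendsto_omega hregime).div_const 2)
  have e2 : e / ((mu - lam) / C) * (1 / (lam + beta - mu)) * (2 * (lam + beta - mu) / 2) =
      e * C / (mu - lam) := by field_simp
  rw [e2] at h
  exact h

end Limits

end UnreliableQueue

end

/-! ### The main theorem. -/

theorem mainTheorem5 (lam mu beta α₀ C : ℝ)
    (hlam : 0 < lam) (hmu : 0 < mu) (hbeta : 0 < beta) (hα₀ : 0 < α₀)
    (hstab : lam < beta / (α₀ + beta) * mu) (hregime : mu < lam + beta)
    (hC : lam + mu + α₀ + beta ≤ C) :
    (∀ α, 0 < α → α ≤ α₀ →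
      ∃! p, UnreliableQueue.IsStationary ⟨lam, mu, α, beta⟩ p) ∧
    (∃ l : ℕ → ℝ,
      (∀ k : ℕ, Tendsto
        (fun α : ℝ => UnreliableQueue.stationaryDist ⟨lam, mu, α, beta⟩ (k, .up) /
          (UnreliableQueue.constUp ⟨lam, mu, α, beta⟩ C *
            UnreliableQueue.gamma ⟨lam, mu, α, beta⟩ ^ k))
        (𝓝[>] 0) (𝓝 (l k))) ∧
      Tendsto l atTop (𝓝 1)) ∧
    Tendsto (fun α : ℝ => UnreliableQueue.gamma ⟨lam, mu, α, beta⟩) (𝓝[>] 0)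
      (𝓝 (lam / mu)) ∧
    ∃ e : ℝ, 0 < e * C / (mu - lam) ∧
      Tendsto (fun α : ℝ => UnreliableQueue.eta ⟨lam, mu, α, beta⟩ C) (𝓝[>] 0) (𝓝 e) ∧
      Tendsto (fun α : ℝ => UnreliableQueue.constUp ⟨lam, mu, α, beta⟩ C) (𝓝[>] 0)
        (𝓝 (e * C / (mu - lam))) := by
  open UnreliableQueue in
  have hstab' : lam * (α₀ + beta) < beta * mu := by
    rwa [div_mul_eq_mul_div, lt_div_iff₀ (by positivity)] at hstab
  have hs : ∀ α, 0 < α → α ≤ α₀ → lam * (α + beta) < beta * mu := fun α _ h2 =>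
    (mul_le_mul_of_nonneg_left (by linarith) hlam.le).trans_lt hstab'
  have hlm : lam < mu := by nlinarith [mul_pos hlam hα₀]
  have hC0 : 0 < C := by linarith
  have hd : 0 < mu - lam := by linarith
  have hρ : 0 < 1 - lam / mu := by rw [sub_pos, div_lt_one hmu]; exact hlm
  have hη := tendsto_eta hlam hmu hbeta hα₀ hregime hC hs
  have hc := tendsto_constUp hlm hmu hregime hC0 hη
  have hγ := tendsto_gamma hmu hregime
  have hpos : 0 < (1 - lam / mu) * ((mu - lam) / C) * C / (mu - lam) := by positivity
  -- The inner limit equals `1` for every `k`, so the outer limit is that of a constant sequence.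
  refine ⟨fun α h1 h2 => ?_, ⟨fun _ => 1, fun k => ?_, tendsto_const_nhds⟩, hγ, _, hpos, hη, hc⟩
  · exact ⟨_, isStationary_balanceDist hlam hmu h1 hbeta (hs α h1 h2),
      fun p hp => hp.eq_balanceDist hlam hmu h1 hbeta (hs α h1 h2)⟩
  · have hk := ((tendsto_emptyProb (lam := lam) (mu := mu) hbeta).mul
      (tendsto_balanceSol (lam := lam) (mu := mu) (beta := beta) k).1).div
      (hc.mul (hγ.pow k)) (by positivity)
    have e1 : (1 - lam / mu) * (lam / mu) ^ k /
        ((1 - lam / mu) * ((mu - lam) / C) * C / (mu - lam) * (lam / mu) ^ k) = 1 := by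
      have : (1 - lam / mu) * ((mu - lam) / C) * C / (mu - lam) = 1 - lam / mu := by field_simp
      rw [this, div_self (by positivity)]
    rw [e1] at hk
    refine hk.congr' ?_
    filter_upwards [Ioc_mem_nhdsGT hα₀] with α hα
    rw [stationaryDist_eq hlam hmu hα.1 hbeta (hs α hα.1 hα.2)]
    rfl
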